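/- Let $\overline{\mathbb Q}$ be an algebraic closure of $\mathbb Q$, and let $\mathbb Q_{D_4}\subseteq\overline{\mathbb Q}$ be the compositum of all Galois extensions of $\mathbb Q$ in $\overline{\mathbb Q}$ whose Galois group is isomorphic to the dihedral group $D_4$ of order $8$. Let $G$ be a group isomorphic to SmallGroup(64,206), SmallGroup(64,215) or SmallGroup(64,216) (labels of the GAP small groups library). Then $\mathbb Q_{D_4}$ is $G$-complete: every Galois extension $K/\mathbb Q$ with $K\subseteq\overline{\mathbb Q}$ and $\operatorname{Gal}(K/\mathbb Q)\simeq G$ satisfies $K\subseteq\mathbb Q_{D_4}$. Explicitly, each of the three groups has order $64$ and is generated by $a,b,c,d,u,v$ with $u,v$ central, $u^2=v^2=1$, $a^2=b^2=c^2=1$, $[a,b]=v$, $[a,c]=u$, $[a,d]=[b,c]=[c,d]=1$, and in addition: $d^2=u$, $[b,d]=1$ for SmallGroup(64,206); $d^2=1$, $[b,d]=u$ for SmallGroup(64,215); $d^2=u$, $[b,d]=u$ for SmallGroup(64,216). -/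

import Mathlib

/-- The compositum, inside a fixed extension `Ω` of `k` (an algebraic closure of `k`), of all
`D₄` extensions of `k`, that is, of all Galois extensions of `k` whose Galois group is the
dihedral group `D₄` of order `8`. For `k = ℚ` this is the field `ℚ_{D₄}`. -/
def D4Compositum (k Ω : Type*) [Field k] [Field Ω] [Algebra k Ω] : IntermediateField k Ω :=
  ⨆ K ∈ {K : IntermediateField k Ω |
    IsGalois k K ∧ Nonempty ((K ≃ₐ[k] K) ≃* DihedralGroup 4)}, K

/-- An extension `F` of `k` inside `Ω` (an algebraic closure of `k`) is `G`-complete if it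
contains every Galois extension `K / k` with `Gal(K / k) ≃ G`. -/
def IsGComplete {k Ω : Type*} [Field k] [Field Ω] [Algebra k Ω] (F : IntermediateField k Ω)
    (G : Type*) [Group G] : Prop :=
  ∀ K : IntermediateField k Ω, IsGalois k K → Nonempty ((K ≃ₐ[k] K) ≃* G) → K ≤ F

/-- Names of the six generators of a power-commutator presentation of a group of order `64`. -/
inductive PcGen : Type
  | a | b | c | d | u | v

namespace PcGen

open scoped commutatorElement in
/-- Relators of the group on the generators `a, b, c, d, u, v` in which `u, v` are central, the
square of a generator `x` is the word `sq x`, and the commutators of the generators `a, b, c, d` are the words given by `ab, ac, ad, bc, bd, cd`. -/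
def rels (sq : PcGen → FreeGroup PcGen) (ab ac ad bc bd cd : FreeGroup PcGen) :
    Set (FreeGroup PcGen) :=
  let g : PcGen → FreeGroup PcGen := FreeGroup.of
  {r | ∃ x, r = g x ^ 2 * (sq x)⁻¹} ∪
  {r | ∃ x, r = ⁅g x, g u⁆} ∪ {r | ∃ x, r = ⁅g x, g v⁆} ∪
  {⁅g a, g b⁆ * ab⁻¹, ⁅g a, g c⁆ * ac⁻¹, ⁅g a, g d⁆ * ad⁻¹,
    ⁅g b, g c⁆ * bc⁻¹, ⁅g b, g d⁆ * bd⁻¹, ⁅g c, g d⁆ * cd⁻¹}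

/-- All six generators are involutions. -/
def sqTrivial : PcGen → FreeGroup PcGen := fun _ => 1

/-- The generators `a, b, c, u, v` are involutions and `d ^ 2 = u`. -/
def sqD : PcGen → FreeGroup PcGen
  | d => FreeGroup.of u
  | _ => 1

end PcGen

open PcGen in
/-- `SmallGroup(64, 206)`: `u, v` are central involutions, `a² = b² = c² = 1`, `d² = u`,
`[a, b] = v`, `[a, c] = u`, and the other pairs of generators commute. It is the central product
of the wreath product `C₂² ≀ C₂` and a cyclic group `⟨d⟩` of order `4`. -/
abbrev SmallGroup64_206 : Type :=
  PresentedGroup (rels sqD (FreeGroup.of v) (FreeGroup.of u) 1 1 1 1)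

open PcGen in
/-- `SmallGroup(64, 215)`: `u, v` are central involutions, `a² = b² = c² = d² = 1`, `[a, b] = v`,
`[a, c] = [b, d] = u`, and the other pairs of generators commute. -/
abbrev SmallGroup64_215 : Type :=
  PresentedGroup (rels sqTrivial (FreeGroup.of v) (FreeGroup.of u) 1 1 (FreeGroup.of u) 1)

open PcGen in
/-- `SmallGroup(64, 216)`: `u, v` are central involutions, `a² = b² = c² = 1`, `d² = u`,
`[a, b] = v`, `[a, c] = [b, d] = u`, and the other pairs of generators commute. -/
abbrev SmallGroup64_216 : Type :=
  PresentedGroup (rels sqD (FreeGroup.of v) (FreeGroup.of u) 1 1 (FreeGroup.of u) 1)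

/-!
Write `Γ` for the Galois group of `Ω / ℚ` and `Γ'` for the subgroup fixing `ℚ_{D₄}`. Each of the
three groups is a central extension of `𝔽₂ ^ 4` by `𝔽₂ ^ 2`, so that a Galois extension `K` with
this group amounts to quadratic characters `α, β, γ, δ` of `Γ` and two continuous cochains
`Γ → 𝔽₂` whose coboundaries are cup products: `α ∪ β` for the coordinate `v`, and `α ∪ γ + β' ∪ δ`
for the coordinate `u`, where `β'` is `δ`, `β` or `β + δ`. The theorem says that all six functions
vanish on `Γ'`.

For a single cup product `χ ∪ ψ` of independent characters this holds because
`(g ↦ (χ g, ψ g, f g))` is a surjection onto `D₄` (`TrivializesCup.vanish_of_independent`). Over `ℚ`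
every nontrivial `χ` has a trivial cup product with some independent `ψ`: if `χ` belongs to `ℚ(√x)`,
one takes for `ψ` the character of a norm `s ^ 2 - x` of odd valuation at a prime not dividing `x`
(`IsQuadraticChar.exists_independent_trivializesCup`). This settles quadratic characters, and by
`χ ∪ χ = (χ + ψ) ∪ χ + ψ ∪ χ` it settles dependent characters as well (`TrivializesCup.vanish`).

A trivial sum `α ∪ γ + β ∪ δ` is reduced to this case by the common slot lemma for quaternion
algebras (`exists_common_slot`): there is a character `ε` for which the three cup products in
`α ∪ γ + β ∪ δ = ε ∪ (γ + δ) + (α + ε) ∪ γ + (β + ε) ∪ δ`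
are trivial. It is proved here without quaternion algebras. The trivializing cochain has an
eigenvector in `Ω`, which yields elements of the biquadratic field of `γ` and `δ` with prescribed
relative norms; Hilbert's Theorem 90 turns these into elements of the three quadratic subfields
whose norms express the triviality of the three cup products (`exists_trivializesCup_of_norm`).
-/

/-! ### Quadratic characters and cochains with values in `𝔽₂` -/

section Cochains

variable {k Ω : Type*} [Field k] [Field Ω] [Algebra k Ω]

/-- A continuous homomorphism from the Galois group of `Ω / k` to the additive group `𝔽₂`. -/
structure IsQuadraticChar (χ : (Ω ≃ₐ[k] Ω) → ZMod 2) : Prop where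
  locConst : IsLocallyConstant χ
  map_mul : ∀ g h, χ (g * h) = χ g + χ h

/-- The continuous `1`-cochain `f` has the `2`-cocycle `(g, h) ↦ χ g * ψ h`, which represents the
cup product `χ ∪ ψ`, as its coboundary. Signs play no role modulo `2`. -/
structure TrivializesCup (χ ψ f : (Ω ≃ₐ[k] Ω) → ZMod 2) : Prop where
  locConst : IsLocallyConstant f
  map_mul : ∀ g h, f (g * h) = f g + f h + χ g * ψ h

/-- The sign `(-1) ^ e` of a class `e` modulo `2`, as an element of the field `F`. -/
def zsgn (F : Type*) [Field F] (e : ZMod 2) : F := if e = 0 then 1 else -1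

lemma ZMod.two_eq_zero_or_one (e : ZMod 2) : e = 0 ∨ e = 1 := by
  revert e; decide

lemma zsgn_zero (F : Type*) [Field F] : zsgn F 0 = 1 := by simp [zsgn]

lemma zsgn_one (F : Type*) [Field F] : zsgn F 1 = -1 := by simp [zsgn]

lemma zsgn_add (F : Type*) [Field F] (a b : ZMod 2) : zsgn F (a + b) = zsgn F a * zsgn F b := by
  rcases ZMod.two_eq_zero_or_one a with rfl | rfl <;>
  rcases ZMod.two_eq_zero_or_one b with rfl | rfl <;>
  simp [zsgn, CharTwo.add_self_eq_zero]

lemma zsgn_mul_self (F : Type*) [Field F] (a : ZMod 2) : zsgn F a * zsgn F a = 1 := by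
  rw [← zsgn_add, CharTwo.add_self_eq_zero, zsgn_zero]

lemma zsgn_ne_zero (F : Type*) [Field F] (a : ZMod 2) : zsgn F a ≠ 0 :=
  fun h ↦ by simpa [h] using zsgn_mul_self F a

lemma map_zsgn (g : Ω ≃ₐ[k] Ω) (a : ZMod 2) : g (zsgn Ω a) = zsgn Ω a := by
  rcases ZMod.two_eq_zero_or_one a with rfl | rfl <;> simp [zsgn]

lemma zsgn_inj {F : Type*} [Field F] [NeZero (2 : F)] {a b : ZMod 2} (h : zsgn F a = zsgn F b) :
    a = b := by
  have h2 : (2 : F) ≠ 0 := NeZero.ne _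
  rcases ZMod.two_eq_zero_or_one a with rfl | rfl <;>
  rcases ZMod.two_eq_zero_or_one b with rfl | rfl <;> simp [zsgn] at h ⊢
  · exact h2 (by linear_combination h)
  · exact h2 (by linear_combination -h)

lemma zsgn_mul_inj {F : Type*} [Field F] [NeZero (2 : F)] {a b : ZMod 2} {w : F} (hw : w ≠ 0)
    (h : zsgn F a * w = zsgn F b * w) : a = b :=
  zsgn_inj (mul_right_cancel₀ hw h)

lemma exists_zsgn_of_sq_eq {F : Type*} [Field F] {x y : F} (h : x ^ 2 = y ^ 2) :
    ∃ e, x = zsgn F e * y := by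
  rcases sq_eq_sq_iff_eq_or_eq_neg.1 h with h | h
  · exact ⟨0, by simp [zsgn, h]⟩
  · exact ⟨1, by simp [zsgn, h]⟩

namespace IsQuadraticChar

variable {χ ψ : (Ω ≃ₐ[k] Ω) → ZMod 2}

lemma add (hχ : IsQuadraticChar χ) (hψ : IsQuadraticChar ψ) :
    IsQuadraticChar (fun g ↦ χ g + ψ g) where
  locConst := hχ.locConst.comp₂ hψ.locConst (· + ·)
  map_mul g h := by rw [hχ.map_mul, hψ.map_mul]; ring

lemma map_one (hχ : IsQuadraticChar χ) : χ 1 = 0 := by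
  simpa using hχ.map_mul 1 1

lemma map_inv (hχ : IsQuadraticChar χ) (g : Ω ≃ₐ[k] Ω) : χ g⁻¹ = χ g := by
  have h := hχ.map_mul g g⁻¹
  rw [mul_inv_cancel, hχ.map_one] at h
  exact (CharTwo.add_eq_zero.1 h.symm).symm

end IsQuadraticChar

open scoped Topology in
/-- The Galois action on a fixed `x` is locally constant. -/
lemma isLocallyConstant_apply [Algebra.IsIntegral k Ω] (x : Ω) :
    IsLocallyConstant (fun g : Ω ≃ₐ[k] Ω ↦ g x) := by
  rw [IsLocallyConstant.iff_eventually_eq]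
  intro g
  have h1 : {h : Ω ≃ₐ[k] Ω | g⁻¹ * h ∈ MulAction.stabilizer (Ω ≃ₐ[k] Ω) x} ∈ 𝓝 g := by
    apply IsOpen.mem_nhds
    · exact (stabilizer_isOpen_of_isIntegral x).preimage (continuous_const_mul g⁻¹)
    · simp
  filter_upwards [h1] with h hh
  have : g⁻¹ (h x) = x := hh
  calc h x = (g * g⁻¹) (h x) := by simp
    _ = g x := by rw [AlgEquiv.mul_apply, this]

/-- A nonzero element whose square is rational is an eigenvector of a quadratic character. -/
lemma exists_quadraticChar [Algebra.IsIntegral k Ω] [NeZero (2 : Ω)] {X : Ω} (hX : X ≠ 0)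
    (h : ∀ g : Ω ≃ₐ[k] Ω, g (X ^ 2) = X ^ 2) :
    ∃ χ : (Ω ≃ₐ[k] Ω) → ZMod 2, IsQuadraticChar χ ∧ ∀ g, g X = zsgn Ω (χ g) * X := by
  classical
  have key (g : Ω ≃ₐ[k] Ω) : ∃ e, g X = zsgn Ω e * X :=
    exists_zsgn_of_sq_eq (by rw [← map_pow, h])
  choose χ hχ using key
  refine ⟨χ, ⟨?_, fun g h ↦ ?_⟩, hχ⟩
  · have : χ = (fun y ↦ if y = X then 0 else 1) ∘ (fun g : Ω ≃ₐ[k] Ω ↦ g X) := by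
      funext g
      apply zsgn_mul_inj hX
      rw [← hχ]
      by_cases hg : g X = X
      · simp [hg, zsgn_zero]
      · simp only [Function.comp, hg, if_false]
        rcases ZMod.two_eq_zero_or_one (χ g) with h0 | h0
        · exact absurd (by rw [hχ, h0, zsgn_zero, one_mul]) hg
        · rw [hχ, h0]
    rw [this]
    exact (isLocallyConstant_apply X).comp _
  · apply zsgn_mul_inj hX
    rw [← hχ, AlgEquiv.mul_apply, hχ h, map_mul, map_zsgn, hχ g, zsgn_add]; ring

/-- Over an open subgroup `H`, every continuous character `H → 𝔽₂` occurs in the Galois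
action. If it is nontrivial, one takes `w = x - h₀ x` with `x` fixed by its kernel but not by
`h₀`. -/
lemma exists_eigenvector [IsGalois k Ω] (H : Subgroup (Ω ≃ₐ[k] Ω))
    (hH : IsOpen (H : Set (Ω ≃ₐ[k] Ω))) {f : (Ω ≃ₐ[k] Ω) → ZMod 2} (hf : IsLocallyConstant f)
    (hmul : ∀ g ∈ H, ∀ h ∈ H, f (g * h) = f g + f h) :
    ∃ w : Ω, w ≠ 0 ∧ ∀ h ∈ H, h w = zsgn Ω (f h) * w := by
  have h1 : f 1 = 0 := by simpa using hmul 1 H.one_mem 1 H.one_mem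
  have hinv : ∀ g ∈ H, f g⁻¹ = f g := fun g hg ↦ by
    have h := hmul g hg g⁻¹ (H.inv_mem hg)
    rw [mul_inv_cancel, h1] at h
    exact (CharTwo.add_eq_zero.1 h.symm).symm
  let J : Subgroup (Ω ≃ₐ[k] Ω) :=
    { carrier := {g | g ∈ H ∧ f g = 0}
      one_mem' := ⟨H.one_mem, h1⟩
      mul_mem' := fun {a b} ha hb ↦
        ⟨H.mul_mem ha.1 hb.1, by rw [hmul a ha.1 b hb.1, ha.2, hb.2, add_zero]⟩
      inv_mem' := fun {a} ha ↦ ⟨H.inv_mem ha.1, by rw [hinv a ha.1, ha.2]⟩ }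
  have hJ : IsOpen (J : Set (Ω ≃ₐ[k] Ω)) := hH.inter (hf.isOpen_fiber 0)
  have hfix : (IntermediateField.fixedField J).fixingSubgroup = J :=
    InfiniteGalois.fixingSubgroup_fixedField (k := k) (K := Ω)
      ⟨J, Subgroup.isClosed_of_isOpen J hJ⟩
  by_cases htriv : ∀ h ∈ H, f h = 0
  · exact ⟨1, one_ne_zero, fun h hh ↦ by simp [htriv h hh, zsgn_zero]⟩
  push Not at htriv
  obtain ⟨h₀, hh₀, hf₀⟩ := htriv
  have hf₀ : f h₀ = 1 := (ZMod.two_eq_zero_or_one _).resolve_left hf₀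
  have hnot : h₀ ∉ (IntermediateField.fixedField J).fixingSubgroup := by
    rw [hfix]; intro h; have := h.2; rw [hf₀] at this; exact one_ne_zero this
  rw [IntermediateField.mem_fixingSubgroup_iff] at hnot
  push Not at hnot
  obtain ⟨x, hx, hne⟩ := hnot
  have hx' : ∀ g ∈ H, f g = 0 → g x = x := fun g hg h0 ↦
    (IntermediateField.mem_fixedField_iff J x).1 hx g ⟨hg, h0⟩
  have hx1 : ∀ g ∈ H, f g = 1 → g x = h₀ x := fun g hg h0 ↦ by
    have := hx' (h₀⁻¹ * g) (H.mul_mem (H.inv_mem hh₀) hg) (by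
      rw [hmul _ (H.inv_mem hh₀) _ hg, hinv _ hh₀, hf₀, h0]; rfl)
    conv_rhs => rw [← this]
    rw [← AlgEquiv.mul_apply, mul_inv_cancel_left]
  refine ⟨x - h₀ x, sub_ne_zero.2 hne.symm, fun h hh ↦ ?_⟩
  rw [map_sub, ← AlgEquiv.mul_apply]
  rcases ZMod.two_eq_zero_or_one (f h) with h0 | h0
  · rw [hx' h hh h0, hx1 (h * h₀) (H.mul_mem hh hh₀) (by rw [hmul _ hh _ hh₀, h0, hf₀, zero_add]),
      h0, zsgn_zero, one_mul]
  · rw [hx1 h hh h0, hx' (h * h₀) (H.mul_mem hh hh₀) (by rw [hmul _ hh _ hh₀, h0, hf₀]; rfl),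
      h0, zsgn_one]
    ring

lemma IsQuadraticChar.exists_eigenvector [IsGalois k Ω] {χ : (Ω ≃ₐ[k] Ω) → ZMod 2}
    (hχ : IsQuadraticChar χ) : ∃ X : Ω, X ≠ 0 ∧ ∀ g : Ω ≃ₐ[k] Ω, g X = zsgn Ω (χ g) * X := by
  obtain ⟨X, hX, h⟩ := _root_.exists_eigenvector (k := k) (Ω := Ω) ⊤ (by simp) hχ.locConst
    fun g _ h _ ↦ hχ.map_mul g h
  exact ⟨X, hX, fun g ↦ h g trivial⟩

/-- If the square `Y ^ 2` of an eigenvector for `ψ` is the norm of an element `z` of the field cut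
out by `χ`, then `ψ ∪ χ` is trivial: for `w ^ 2 = z` the conjugates of `w` are `±w` and `±Y / w`,
and the signs in this action form a cochain with coboundary `ψ ∪ χ`. -/
lemma exists_trivializesCup_of_norm [IsAlgClosed Ω] [Algebra.IsIntegral k Ω] [NeZero (2 : Ω)]
    {χ ψ : (Ω ≃ₐ[k] Ω) → ZMod 2} (hχ : IsQuadraticChar χ) {z Y : Ω}
    (hY : Y ≠ 0) (hz : z ≠ 0) (hψ : ∀ g : Ω ≃ₐ[k] Ω, g Y = zsgn Ω (ψ g) * Y)
    (h0 : ∀ g : Ω ≃ₐ[k] Ω, χ g = 0 → g z = z) (h1 : ∀ g : Ω ≃ₐ[k] Ω, χ g = 1 → z * g z = Y ^ 2) :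
    ∃ f, TrivializesCup ψ χ f := by
  classical
  obtain ⟨w, hw⟩ := IsAlgClosed.exists_pow_nat_eq z (n := 2) two_pos
  have hw0 : w ≠ 0 := by rintro rfl; exact hz (by rw [← hw]; simp)
  let v : ZMod 2 → Ω := fun e ↦ if e = 0 then w else Y / w
  have hv0 : ∀ e, v e ≠ 0 := fun e ↦ by
    simp only [v]; split_ifs
    · exact hw0
    · exact div_ne_zero hY hw0
  have hvv : v 0 * v 1 = Y := by simp [v]; field_simp
  have key (g : Ω ≃ₐ[k] Ω) : ∃ e, g w = zsgn Ω e * v (χ g) := by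
    apply exists_zsgn_of_sq_eq
    rw [← map_pow, hw]
    rcases ZMod.two_eq_zero_or_one (χ g) with h | h
    · simp [v, h, h0 g h, hw]
    · have := h1 g h
      simp only [v, h, one_ne_zero, if_false, div_pow, hw, ← this]
      field_simp
  choose f hf using key
  -- the action on the conjugate `Y / w`, deduced from `w * (Y / w) = Y`
  have hf' (g : Ω ≃ₐ[k] Ω) : g (v 1) = zsgn Ω (ψ g + f g) * v (χ g + 1) := by
    have hvv' : v (χ g) * v (χ g + 1) = Y := by
      rcases ZMod.two_eq_zero_or_one (χ g) with h | h
      · rw [h, zero_add, hvv]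
      · rw [h, show (1 : ZMod 2) + 1 = 0 from rfl, mul_comm, hvv]
    have e1 : g w * g (v 1) = zsgn Ω (ψ g) * Y := by
      rw [← map_mul, ← hψ, ← hvv]; simp [v]
    apply mul_left_cancel₀ ((map_ne_zero g).2 hw0)
    rw [e1, hf, zsgn_add, ← hvv']
    linear_combination (-zsgn Ω (ψ g) * v (χ g) * v (χ g + 1)) * zsgn_mul_self Ω (f g)
  refine ⟨f, ?_, fun g h ↦ ?_⟩
  · have : f = (fun p : Ω × ZMod 2 ↦ if p.1 = v p.2 then 0 else 1) ∘
        (fun g : Ω ≃ₐ[k] Ω ↦ (g w, χ g)) := by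
      funext g
      apply zsgn_mul_inj (hv0 (χ g))
      rw [← hf]
      by_cases hg : g w = v (χ g)
      · simp [hg, zsgn_zero]
      · simp only [Function.comp, hg, if_false]
        rcases ZMod.two_eq_zero_or_one (f g) with h0 | h0
        · exact absurd (by rw [hf, h0, zsgn_zero, one_mul]) hg
        · rw [hf, h0]
    rw [this]
    exact ((isLocallyConstant_apply w).prodMk hχ.locConst).comp _
  · apply zsgn_mul_inj (hv0 (χ (g * h)))
    rw [← hf, AlgEquiv.mul_apply, hf h, map_mul, map_zsgn]
    rcases ZMod.two_eq_zero_or_one (χ h) with h | h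
    · rw [h, hχ.map_mul, h, add_zero, mul_zero, add_zero, zsgn_add]
      have := hf g
      simp only [v, if_true] at this ⊢
      rw [this]; ring
    · rw [h, hχ.map_mul, h, hf', mul_one]
      simp only [zsgn_add]; ring

end Cochains

/-! ### Dihedral extensions and cup products -/

section Dihedral

variable {k Ω : Type*} [Field k] [Field Ω] [Algebra k Ω]

/-- The identification of `𝔽₂ ^ 3`, multiplied by
`(x, y, z) (x', y', z') = (x + x', y + y', z + z' + x y')`, with the dihedral group. -/
def heisToDihedral (x y z : ZMod 2) : DihedralGroup 4 :=
  .sr 1 ^ y.val * .sr 0 ^ x.val * .r 2 ^ z.val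

lemma heisToDihedral_mul (x y z x' y' z' : ZMod 2) :
    heisToDihedral (x + x') (y + y') (z + z' + x * y') =
      heisToDihedral x y z * heisToDihedral x' y' z' := by
  revert x y z x' y' z'; decide

lemma heisToDihedral_eq_one {x y z : ZMod 2} (h : heisToDihedral x y z = 1) :
    x = 0 ∧ y = 0 ∧ z = 0 := by
  revert x y z; decide

lemma heisToDihedral_generate (p q : ZMod 2) (t : DihedralGroup 4) :
    ∃ i j l : Fin 2, t = heisToDihedral 1 0 p ^ i.val * heisToDihedral 0 1 q ^ j.val *
      ((heisToDihedral 1 0 p * heisToDihedral 0 1 q) ^ 2) ^ l.val := by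
  revert p q t; decide

/-- The kernel of `ψ` is not contained in that of a character `χ` other than `0` and `ψ`, as the
kernels have index at most two. -/
lemma IsQuadraticChar.exists_one_zero {χ ψ : (Ω ≃ₐ[k] Ω) → ZMod 2} (hχ : IsQuadraticChar χ)
    (hψ : IsQuadraticChar ψ) (h1 : χ ≠ 0) (h3 : χ ≠ ψ) :
    ∃ g, χ g = 1 ∧ ψ g = 0 := by
  obtain ⟨g, hg⟩ := Function.ne_iff.1 h1
  obtain ⟨h, hh⟩ := Function.ne_iff.1 h3
  replace hg := (ZMod.two_eq_zero_or_one _).resolve_left hg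
  rcases ZMod.two_eq_zero_or_one (ψ g) with hg' | hg'
  · exact ⟨g, hg, hg'⟩
  rcases ZMod.two_eq_zero_or_one (χ h) with hh1 | hh1 <;>
  rcases ZMod.two_eq_zero_or_one (ψ h) with hh2 | hh2
  · exact absurd (hh1.trans hh2.symm) hh
  · exact ⟨g * h, by rw [hχ.map_mul, hg, hh1, add_zero], by rw [hψ.map_mul, hg', hh2]; rfl⟩
  · exact ⟨h, hh1, hh2⟩
  · exact absurd (hh1.trans hh2.symm) hh

/-- A cochain with coboundary `χ ∪ ψ`, for independent `χ` and `ψ`, is one of the coordinates of a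
continuous surjection onto `D₄`. Hence it is trivial over the compositum of the `D₄` extensions. -/
lemma TrivializesCup.vanish_of_independent [IsGalois k Ω] {χ ψ f : (Ω ≃ₐ[k] Ω) → ZMod 2}
    (hχ : IsQuadraticChar χ) (hψ : IsQuadraticChar ψ) (hf : TrivializesCup χ ψ f)
    (h1 : χ ≠ 0) (h2 : ψ ≠ 0) (h3 : χ ≠ ψ) {σ : Ω ≃ₐ[k] Ω}
    (hσ : σ ∈ (D4Compositum k Ω).fixingSubgroup) : χ σ = 0 ∧ ψ σ = 0 ∧ f σ = 0 := by
  let ρ : (Ω ≃ₐ[k] Ω) →* DihedralGroup 4 :=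
    MonoidHom.mk' (fun g ↦ heisToDihedral (χ g) (ψ g) (f g)) fun g h ↦ by
      rw [hχ.map_mul, hψ.map_mul, hf.map_mul, heisToDihedral_mul]
  have hρ : Function.Surjective ρ := fun t ↦ by
    obtain ⟨g, hg, hg'⟩ := hχ.exists_one_zero hψ h1 h3
    obtain ⟨h, hh', hh⟩ := hψ.exists_one_zero hχ h2 h3.symm
    obtain ⟨i, j, l, rfl⟩ := heisToDihedral_generate (f g) (f h) t
    refine ⟨g ^ i.val * h ^ j.val * ((g * h) ^ 2) ^ l.val, ?_⟩
    have e1 : ρ g = heisToDihedral 1 0 (f g) := by simp [ρ, hg, hg']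
    have e2 : ρ h = heisToDihedral 0 1 (f h) := by simp [ρ, hh, hh']
    simp only [_root_.map_mul, map_pow, e1, e2]
  have hopen : IsOpen (ρ.ker : Set (Ω ≃ₐ[k] Ω)) :=
    ((hχ.locConst.prodMk (hψ.locConst.prodMk hf.locConst)).comp
      fun p : ZMod 2 × ZMod 2 × ZMod 2 ↦ heisToDihedral p.1 p.2.1 p.2.2).isOpen_fiber 1
  let N : ClosedSubgroup (Ω ≃ₐ[k] Ω) := ⟨ρ.ker, Subgroup.isClosed_of_isOpen _ hopen⟩
  have hNfix : (IntermediateField.fixedField ρ.ker).fixingSubgroup = ρ.ker :=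
    InfiniteGalois.fixingSubgroup_fixedField N
  have : N.Normal := inferInstanceAs ρ.ker.Normal
  have hgal : IsGalois k (IntermediateField.fixedField ρ.ker) := by
    rw [← InfiniteGalois.normal_iff_isGalois, hNfix]; infer_instance
  have hle : IntermediateField.fixedField ρ.ker ≤ D4Compositum k Ω :=
    le_iSup₂_of_le (f := fun (K : IntermediateField k Ω) (_ : K ∈ {K : IntermediateField k Ω |
      IsGalois k K ∧ Nonempty ((K ≃ₐ[k] K) ≃* DihedralGroup 4)}) ↦ K) _
      ⟨hgal, ⟨(InfiniteGalois.normalAutEquivQuotient N).symm.trans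
        (QuotientGroup.quotientKerEquivOfSurjective ρ hρ)⟩⟩ le_rfl
  have hker : σ ∈ ρ.ker := hNfix ▸ IntermediateField.fixingSubgroup_antitone hle hσ
  exact heisToDihedral_eq_one hker

end Dihedral

/-! ### Quadratic characters over the rational numbers -/

/-- A prime `p` dividing `4 x - 1` does not divide `x`, and it divides `s ^ 2 - x` exactly once for
`s = 2 x` or for `s = 2 x + p`. Hence neither `s ^ 2 - x` nor its product with `x` is a square. -/
lemma Int.exists_sq_sub_not_isSquare {x : ℤ} (hx : x ≠ 0) :
    ∃ s : ℤ, ¬ IsSquare (s ^ 2 - x) ∧ ¬ IsSquare (x * (s ^ 2 - x)) := by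
  obtain ⟨p, hp, hpd⟩ := Nat.exists_prime_and_dvd (n := (4 * x - 1).natAbs) (by omega)
  have hpd : (p : ℤ) ∣ 4 * x - 1 := Int.natCast_dvd.2 hpd
  have hp' : Prime (p : ℤ) := Nat.prime_iff_prime_int.1 hp
  have hpx : ¬ (p : ℤ) ∣ 4 * x := fun h ↦ hp'.not_dvd_one (by
    have := Int.dvd_sub h hpd
    rwa [sub_sub_cancel] at this)
  have hpx' : ¬ (p : ℤ) ∣ x := fun h ↦ hpx (h.mul_left 4)
  -- a square divisible by `p` is divisible by `p ^ 2`
  have hsq : ∀ y : ℤ, (p : ℤ) ∣ y → IsSquare y → (p : ℤ) ^ 2 ∣ y := by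
    rintro _ h ⟨r, rfl⟩
    rw [← pow_two] at h ⊢
    exact pow_dvd_pow_of_dvd (hp'.dvd_of_dvd_pow h) 2
  have hfin : ∀ s : ℤ, (p : ℤ) ∣ s ^ 2 - x → ¬ (p : ℤ) ^ 2 ∣ s ^ 2 - x →
      ¬ IsSquare (s ^ 2 - x) ∧ ¬ IsSquare (x * (s ^ 2 - x)) := fun s h1 h2 ↦
    ⟨fun h ↦ h2 (hsq _ h1 h), fun h ↦ h2
      ((IsCoprime.pow_left ((Prime.coprime_iff_not_dvd hp').2 hpx')).dvd_of_dvd_mul_left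
        (hsq _ (h1.mul_left x) h))⟩
  have hd1 : (p : ℤ) ∣ (2 * x) ^ 2 - x := by
    obtain ⟨r, hr⟩ := hpd
    exact ⟨x * r, by linear_combination x * hr⟩
  by_cases h2 : (p : ℤ) ^ 2 ∣ (2 * x) ^ 2 - x
  · refine ⟨2 * x + p, hfin _ ?_ fun h ↦ hpx ?_⟩
    · obtain ⟨r, hr⟩ := hd1
      exact ⟨r + 4 * x + p, by linear_combination hr⟩
    · obtain ⟨r, hr⟩ := h2
      obtain ⟨t, ht⟩ := h
      refine ⟨t - r - 1, mul_left_cancel₀ hp'.ne_zero ?_⟩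
      linear_combination ht - hr
  · exact ⟨2 * x, hfin _ hd1 h2⟩

section Rational

variable {Ω : Type*} [Field Ω] [Algebra ℚ Ω]

/-- Every nontrivial quadratic character of `ℚ` takes part in a trivial cup product with a
character independent of it, so that every quadratic field lies in a `D₄` extension. -/
lemma IsQuadraticChar.exists_independent_trivializesCup [IsGalois ℚ Ω] [IsAlgClosed Ω]
    {χ : (Ω ≃ₐ[ℚ] Ω) → ZMod 2} (hχ : IsQuadraticChar χ) (h0 : χ ≠ 0) :
    ∃ ψ f, IsQuadraticChar ψ ∧ ψ ≠ 0 ∧ ψ ≠ χ ∧ TrivializesCup ψ χ f := by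
  have : CharZero Ω := algebraRat.charZero Ω
  obtain ⟨X, hX, hgX⟩ := hχ.exists_eigenvector
  obtain ⟨r, hr⟩ := (InfiniteGalois.mem_range_algebraMap_iff_fixed (k := ℚ) (X ^ 2)).2 fun g ↦ by
    rw [map_pow, hgX, mul_pow, pow_two (zsgn _ _), zsgn_mul_self, one_mul]
  have hr0 : r ≠ 0 := by
    rintro rfl
    exact pow_ne_zero 2 hX (by rw [← hr, map_zero])
  -- clearing denominators replaces `X` by `X'`, whose square is an integer
  have hden : (r.den : Ω) ≠ 0 := Nat.cast_ne_zero.2 r.den_ne_zero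
  set X' : Ω := r.den * X with hX'
  set x : ℤ := r.den * r.num with hx
  have hX'0 : X' ≠ 0 := mul_ne_zero hden hX
  have hX'2 : X' ^ 2 = (x : Ω) := by
    have e : (r : Ω) = X ^ 2 := by rw [← hr, eq_ratCast]
    rw [hX', mul_pow, ← e, hx]
    nth_rewrite 2 [← Rat.num_div_den r]
    push_cast
    field_simp
  have hgX' (g : Ω ≃ₐ[ℚ] Ω) : g X' = zsgn Ω (χ g) * X' := by
    rw [hX', _root_.map_mul, map_natCast, hgX]; ring
  have hx0 : x ≠ 0 := mul_ne_zero (by exact_mod_cast r.den_ne_zero) (Rat.num_ne_zero.2 hr0)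
  obtain ⟨s, hs1, hs2⟩ := Int.exists_sq_sub_not_isSquare hx0
  -- a fixed square root of an integer shows that integer to be a square
  have hfixed (y : ℤ) (Y : Ω) (hY : Y ^ 2 = (y : Ω)) (hg : ∀ g : Ω ≃ₐ[ℚ] Ω, g Y = Y) :
      IsSquare y := by
    obtain ⟨q, hq⟩ := (InfiniteGalois.mem_range_algebraMap_iff_fixed (k := ℚ) Y).2 hg
    rw [← Rat.isSquare_intCast_iff]
    refine ⟨q, ?_⟩
    have : ((y : ℚ) : Ω) = ((q * q : ℚ) : Ω) := by
      rw [← eq_ratCast (algebraMap ℚ Ω) (q * q), _root_.map_mul, hq, Rat.cast_intCast, ← hY,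
        pow_two]
    exact_mod_cast this
  have hy0 : s ^ 2 - x ≠ 0 := fun h ↦ hs1 (by rw [h]; exact ⟨0, rfl⟩)
  obtain ⟨Y, hY⟩ := IsAlgClosed.exists_pow_nat_eq ((s ^ 2 - x : ℤ) : Ω) (n := 2) two_pos
  have hY0 : Y ≠ 0 := by
    rintro rfl
    rw [zero_pow two_ne_zero] at hY
    exact hy0 (by exact_mod_cast hY.symm)
  obtain ⟨ψ, hψ, hgY⟩ := exists_quadraticChar (k := ℚ) hY0 fun g ↦ by rw [hY, map_intCast]
  have hnorm : (s + X') * (s - X') = Y ^ 2 := by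
    rw [hY]; push_cast; rw [← hX'2]; ring
  obtain ⟨f, hf⟩ := exists_trivializesCup_of_norm (z := s + X') hχ hY0
    (left_ne_zero_of_mul (hnorm ▸ pow_ne_zero 2 hY0)) hgY
    (fun g hg ↦ by rw [map_add, map_intCast, hgX', hg, zsgn_zero, one_mul])
    (fun g hg ↦ by
      rw [map_add, map_intCast, hgX', hg, zsgn_one, ← hnorm]; ring)
  refine ⟨ψ, f, hψ, ?_, ?_, hf⟩
  · rintro rfl
    exact hs1 (hfixed _ Y hY fun g ↦ by rw [hgY]; simp [zsgn_zero])
  · rintro rfl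
    refine hs2 (hfixed _ (X' * Y) (by rw [mul_pow, hX'2, hY]; push_cast; ring) fun g ↦ ?_)
    rw [_root_.map_mul, hgX', hgY]
    linear_combination X' * Y * zsgn_mul_self Ω (ψ g)

variable [IsGalois ℚ Ω] [IsAlgClosed Ω] {σ : Ω ≃ₐ[ℚ] Ω}

/-- All quadratic fields are contained in the compositum of the `D₄` extensions of `ℚ`. -/
lemma IsQuadraticChar.vanish {χ : (Ω ≃ₐ[ℚ] Ω) → ZMod 2} (hχ : IsQuadraticChar χ)
    (hσ : σ ∈ (D4Compositum ℚ Ω).fixingSubgroup) : χ σ = 0 := by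
  by_cases h0 : χ = 0
  · rw [h0]; rfl
  · obtain ⟨ψ, f, hψ, h1, h2, hf⟩ := hχ.exists_independent_trivializesCup h0
    exact (hf.vanish_of_independent hψ hχ h1 h0 h2 hσ).2.1

/-- The extension defined by a trivial cup product of two arbitrary characters is contained in the
compositum of the `D₄` extensions of `ℚ`. For equal characters this is a cyclic extension of
degree four, which lies in the compositum of two `D₄` extensions as
`χ ∪ χ = (χ + ψ) ∪ χ + ψ ∪ χ`. -/
lemma TrivializesCup.vanish {χ ψ f : (Ω ≃ₐ[ℚ] Ω) → ZMod 2} (hχ : IsQuadraticChar χ)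
    (hψ : IsQuadraticChar ψ) (hf : TrivializesCup χ ψ f)
    (hσ : σ ∈ (D4Compositum ℚ Ω).fixingSubgroup) : f σ = 0 := by
  by_cases h1 : χ = 0
  · exact IsQuadraticChar.vanish ⟨hf.locConst, by simpa [h1] using hf.map_mul⟩ hσ
  by_cases h2 : ψ = 0
  · exact IsQuadraticChar.vanish ⟨hf.locConst, by simpa [h2] using hf.map_mul⟩ hσ
  by_cases h3 : χ = ψ
  · subst h3
    obtain ⟨ψ, f', hψ, h4, h5, hf'⟩ := hχ.exists_independent_trivializesCup h1
    have hsum : TrivializesCup (fun g ↦ χ g + ψ g) χ (fun g ↦ f g + f' g) :=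
      ⟨hf.locConst.comp₂ hf'.locConst (· + ·), fun g h ↦ by
        rw [hf.map_mul, hf'.map_mul]; ring⟩
    have h6 := (hf'.vanish_of_independent hψ hχ h4 h1 h5 hσ).2.2
    have h7 := (hsum.vanish_of_independent (hχ.add hψ) hχ
      (fun h ↦ h5 (funext fun g ↦ (CharTwo.add_eq_zero.1 (congrFun h g)).symm)) h1
      (fun h ↦ h4 (funext fun g ↦ add_eq_left.1 (congrFun h g))) hσ).2.2
    rwa [h6, add_zero] at h7
  · exact (hf.vanish_of_independent hχ hψ h1 h2 h3 hσ).2.2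

end Rational

/-! ### Sums of two cup products -/

section CommonSlot

variable {k Ω : Type*} [Field k] [Field Ω] [Algebra k Ω]

/-- An element fixed by the common kernel of `γ` and `δ` has the same image under all `g` with given
`γ g` and `δ g`. -/
lemma apply_eq_of_fixed {γ δ : (Ω ≃ₐ[k] Ω) → ZMod 2} (hγ : IsQuadraticChar γ)
    (hδ : IsQuadraticChar δ) {z : Ω} (hz : ∀ h : Ω ≃ₐ[k] Ω, γ h = 0 → δ h = 0 → h z = z)
    {g g' : Ω ≃ₐ[k] Ω} (h1 : γ g = γ g') (h2 : δ g = δ g') : g z = g' z := by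
  have := hz (g'⁻¹ * g)
    (by rw [hγ.map_mul, hγ.map_inv, h1, CharTwo.add_self_eq_zero])
    (by rw [hδ.map_mul, hδ.map_inv, h2, CharTwo.add_self_eq_zero])
  conv_rhs => rw [← this]
  rw [← AlgEquiv.mul_apply, mul_inv_cancel_left]

/-- A cochain with coboundary `α ∪ γ + β ∪ δ` restricts to a character of the common kernel of `γ`
and `δ`. An eigenvector `w` of that character yields the elements `μ = A c(w) / w` and
`ν = B d(w) / w` of the field cut out by `γ` and `δ`, where `A` and `B` are
eigenvectors of `α` and `β`, and the twisted action commutes: `μ c(ν) = ν d(μ)`. -/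
lemma exists_norm_pair [IsGalois k Ω] {α β γ δ f : (Ω ≃ₐ[k] Ω) → ZMod 2}
    (hα : IsQuadraticChar α) (hβ : IsQuadraticChar β) (hγ : IsQuadraticChar γ)
    (hδ : IsQuadraticChar δ) (hf : IsLocallyConstant f)
    (hmul : ∀ g h, f (g * h) = f g + f h + (α g * γ h + β g * δ h))
    {c d : Ω ≃ₐ[k] Ω} (hc : γ c = 1) (hc' : δ c = 0) (hd : γ d = 0) (hd' : δ d = 1) :
    ∃ A B μ ν : Ω, A ≠ 0 ∧ B ≠ 0 ∧ μ ≠ 0 ∧ ν ≠ 0 ∧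
      (∀ g : Ω ≃ₐ[k] Ω, g A = zsgn Ω (α g) * A) ∧ (∀ g : Ω ≃ₐ[k] Ω, g B = zsgn Ω (β g) * B) ∧
      (∀ h : Ω ≃ₐ[k] Ω, γ h = 0 → δ h = 0 → h μ = μ) ∧
      (∀ h : Ω ≃ₐ[k] Ω, γ h = 0 → δ h = 0 → h ν = ν) ∧
      μ * c μ = A ^ 2 ∧ ν * d ν = B ^ 2 ∧ μ * c ν = ν * d μ := by
  obtain ⟨A, hA, hgA⟩ := hα.exists_eigenvector
  obtain ⟨B, hB, hgB⟩ := hβ.exists_eigenvector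
  let H : Subgroup (Ω ≃ₐ[k] Ω) :=
    { carrier := {g | γ g = 0 ∧ δ g = 0}
      one_mem' := ⟨hγ.map_one, hδ.map_one⟩
      mul_mem' := fun {a b} ha hb ↦
        ⟨by rw [hγ.map_mul, ha.1, hb.1, add_zero], by rw [hδ.map_mul, ha.2, hb.2, add_zero]⟩
      inv_mem' := fun {a} ha ↦ ⟨by rw [hγ.map_inv, ha.1], by rw [hδ.map_inv, ha.2]⟩ }
  have hH : IsOpen (H : Set (Ω ≃ₐ[k] Ω)) :=
    (hγ.locConst.isOpen_fiber 0).inter (hδ.locConst.isOpen_fiber 0)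
  obtain ⟨w, hw, hgw⟩ := exists_eigenvector H hH hf fun g _ h hh ↦ by
    rw [hmul, hh.1, hh.2]; ring
  -- the images of `w` are eigenvectors too, for twisted characters of `H`
  have hconj (g h : Ω ≃ₐ[k] Ω) (h1 : γ h = 0) (h2 : δ h = 0) :
      h (g w) = zsgn Ω (f h + α h * γ g + β h * δ g) * g w := by
    have hk1 : γ (g⁻¹ * (h * g)) = 0 := by
      rw [hγ.map_mul, hγ.map_mul, hγ.map_inv, h1, zero_add, CharTwo.add_self_eq_zero]
    have hk2 : δ (g⁻¹ * (h * g)) = 0 := by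
      rw [hδ.map_mul, hδ.map_mul, hδ.map_inv, h2, zero_add, CharTwo.add_self_eq_zero]
    have e := hmul g (g⁻¹ * (h * g))
    rw [mul_inv_cancel_left, hmul, hk1, hk2] at e
    have e' : f (g⁻¹ * (h * g)) = f h + α h * γ g + β h * δ g := by linear_combination -e
    rw [← e', ← map_zsgn g, ← map_mul, ← hgw _ ⟨hk1, hk2⟩, ← AlgEquiv.mul_apply,
      ← AlgEquiv.mul_apply, mul_inv_cancel_left]
  have hcw : c w ≠ 0 := (map_ne_zero c).2 hw
  have hdw : d w ≠ 0 := (map_ne_zero d).2 hw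
  have hcc : c (c w) = zsgn Ω (α c) * w := by
    rw [← AlgEquiv.mul_apply, hgw (c * c) ⟨by rw [hγ.map_mul, CharTwo.add_self_eq_zero],
      by rw [hδ.map_mul, CharTwo.add_self_eq_zero]⟩, hmul, hc, hc', CharTwo.add_self_eq_zero]
    simp
  have hdd : d (d w) = zsgn Ω (β d) * w := by
    rw [← AlgEquiv.mul_apply, hgw (d * d) ⟨by rw [hγ.map_mul, CharTwo.add_self_eq_zero],
      by rw [hδ.map_mul, CharTwo.add_self_eq_zero]⟩, hmul, hd, hd', CharTwo.add_self_eq_zero]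
    simp
  have hcd : c (d w) = zsgn Ω (β c + α d) * d (c w) := by
    obtain ⟨t, hk1, hk2, e1⟩ : ∃ t, γ t = 0 ∧ δ t = 0 ∧ d * (c * t) = c * d := by
      refine ⟨c⁻¹ * (d⁻¹ * (c * d)), ?_, ?_, by group⟩
      · simp only [hγ.map_mul, hγ.map_inv, hc, hd]; rfl
      · simp only [hδ.map_mul, hδ.map_inv, hc', hd']; rfl
    have e2 : f t = β c + α d := by
      have := congrArg f e1
      rw [hmul d, hmul c, hγ.map_mul, hδ.map_mul, hk1, hk2, hmul c, hc, hc', hd, hd'] at this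
      linear_combination this - α d * CharTwo.two_eq_zero (R := ZMod 2)
    rw [← AlgEquiv.mul_apply, ← e1, AlgEquiv.mul_apply, AlgEquiv.mul_apply, hgw _ ⟨hk1, hk2⟩, e2]
    simp only [map_mul, map_zsgn]
  have hfix (g h : Ω ≃ₐ[k] Ω) (X : Ω) (h1 : γ h = 0) (h2 : δ h = 0)
      (hX : h X = zsgn Ω (α h * γ g + β h * δ g) * X) : h (X * g w / w) = X * g w / w := by
    rw [map_div₀, map_mul, hX, hconj g h h1 h2, hgw h ⟨h1, h2⟩, add_assoc, zsgn_add Ω (f h)]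
    have := zsgn_ne_zero Ω (f h)
    field_simp
    linear_combination X * g w * zsgn_mul_self Ω (α h * γ g + β h * δ g)
  refine ⟨A, B, A * c w / w, B * d w / w, hA, hB, div_ne_zero (mul_ne_zero hA hcw) hw,
    div_ne_zero (mul_ne_zero hB hdw) hw, hgA, hgB,
    fun h h1 h2 ↦ hfix c h A h1 h2 (by simp [hc, hc', hgA]),
    fun h h1 h2 ↦ hfix d h B h1 h2 (by simp [hd, hd', hgB]), ?_, ?_, ?_⟩
  · rw [map_div₀, map_mul, hcc, hgA]
    field_simp
    linear_combination zsgn_mul_self Ω (α c)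
  · rw [map_div₀, map_mul, hdd, hgB]
    field_simp
    linear_combination zsgn_mul_self Ω (β d)
  · rw [map_div₀, map_div₀, map_mul, map_mul, hcd, hgA, hgB, zsgn_add]
    field_simp
    linear_combination zsgn Ω (α d) * d (c w) * zsgn_mul_self Ω (β c)

/-- The common slot lemma: if `α ∪ γ + β ∪ δ` is trivial, then `α ∪ γ`, `ε ∪ γ`, `ε ∪ δ` and `β ∪ δ`
are equal for some `ε`. Let `μ`, `ν`, `A`, `B` be as in `exists_norm_pair`, and put `a = A ^ 2` and
`m = μ d(μ)`. Then `m c(m) = a ^ 2`, so that `m = a p / c(p)` for some `p` in the field cut out by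
`γ`. It follows that `ρ = μ / p` has the same image under `c` and `d`, and that `e = ρ c(ρ)` is in
`k`. The elements `ρ`, `p` and `ν / ρ` lie in the fields cut out by `γ + δ`, `γ` and `δ`, and their
norms are `e`, `A ^ 2 / e` and `B ^ 2 / e`. -/
lemma exists_common_slot [IsGalois k Ω] [IsAlgClosed Ω] [NeZero (2 : Ω)]
    {α β γ δ f : (Ω ≃ₐ[k] Ω) → ZMod 2}
    (hα : IsQuadraticChar α) (hβ : IsQuadraticChar β) (hγ : IsQuadraticChar γ)
    (hδ : IsQuadraticChar δ) (hf : IsLocallyConstant f)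
    (hmul : ∀ g h, f (g * h) = f g + f h + (α g * γ h + β g * δ h))
    {c d : Ω ≃ₐ[k] Ω} (hc : γ c = 1) (hc' : δ c = 0) (hd : γ d = 0) (hd' : δ d = 1) :
    ∃ ε f₁ f₂ f₃, IsQuadraticChar ε ∧ TrivializesCup ε (fun g ↦ γ g + δ g) f₁ ∧
      TrivializesCup (fun g ↦ α g + ε g) γ f₂ ∧ TrivializesCup (fun g ↦ β g + ε g) δ f₃ := by
  obtain ⟨A, B, μ, ν, hA, hB, hμ, hν, hgA, hgB, hHμ, hHν, hcμ, hdν, hcdμν⟩ :=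
    exists_norm_pair hα hβ hγ hδ hf hmul hc hc' hd hd'
  obtain ⟨X, hX, hgX⟩ := hγ.exists_eigenvector
  have hA2 (g : Ω ≃ₐ[k] Ω) : g (A ^ 2) = A ^ 2 := by
    rw [map_pow, hgA]; linear_combination A ^ 2 * zsgn_mul_self Ω (α g)
  have hdd {z : Ω} (hz : ∀ h : Ω ≃ₐ[k] Ω, γ h = 0 → δ h = 0 → h z = z) : d (d z) = z :=
    hz (d * d) (by rw [hγ.map_mul, CharTwo.add_self_eq_zero])
      (by rw [hδ.map_mul, CharTwo.add_self_eq_zero])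
  have hcc {z : Ω} (hz : ∀ h : Ω ≃ₐ[k] Ω, γ h = 0 → δ h = 0 → h z = z) : c (c z) = z :=
    hz (c * c) (by rw [hγ.map_mul, CharTwo.add_self_eq_zero])
      (by rw [hδ.map_mul, CharTwo.add_self_eq_zero])
  have hcd {z : Ω} (hz : ∀ h : Ω ≃ₐ[k] Ω, γ h = 0 → δ h = 0 → h z = z) : c (d z) = d (c z) :=
    apply_eq_of_fixed hγ hδ hz (g := c * d) (g' := d * c)
      (by rw [hγ.map_mul, hγ.map_mul, add_comm]) (by rw [hδ.map_mul, hδ.map_mul, add_comm])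
  have hcμ0 : c μ ≠ 0 := (map_ne_zero c).2 hμ
  have hHm (h : Ω ≃ₐ[k] Ω) (h1 : γ h = 0) : h (μ * d μ) = μ * d μ := by
    rcases ZMod.two_eq_zero_or_one (δ h) with h2 | h2
    · rw [map_mul, hHμ h h1 h2, ← AlgEquiv.mul_apply, apply_eq_of_fixed hγ hδ hHμ (g' := d)
        (by rw [hγ.map_mul, h1, zero_add]) (by rw [hδ.map_mul, h2, zero_add])]
    · rw [map_mul, apply_eq_of_fixed hγ hδ hHμ (h1.trans hd.symm) (h2.trans hd'.symm),
        ← AlgEquiv.mul_apply, hHμ (h * d) (by rw [hγ.map_mul, h1, hd, zero_add])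
          (by rw [hδ.map_mul, h2, hd']; rfl), mul_comm]
  have hcm : μ * d μ * c (μ * d μ) = A ^ 2 * A ^ 2 := by
    have := congrArg d hcμ
    rw [hA2, map_mul] at this
    rw [map_mul, hcd hHμ]
    linear_combination (d μ * d (c μ)) * hcμ + A ^ 2 * this
  -- Hilbert's Theorem 90 for `m / a`; the trace `a + m` fails exactly when `m = -a`
  obtain ⟨p, hp, hHp, hpm⟩ : ∃ p : Ω, p ≠ 0 ∧ (∀ h : Ω ≃ₐ[k] Ω, γ h = 0 → h p = p) ∧
      μ * d μ * c p = A ^ 2 * p := by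
    by_cases h : A ^ 2 + μ * d μ = 0
    · refine ⟨X, hX, fun h h1 ↦ by rw [hgX, h1, zsgn_zero, one_mul], ?_⟩
      rw [hgX, hc, zsgn_one]
      linear_combination -X * h
    · refine ⟨A ^ 2 + μ * d μ, h, fun h h1 ↦ by rw [map_add, hA2, hHm h h1], ?_⟩
      rw [map_add, hA2]
      linear_combination hcm
  have hcp0 : c p ≠ 0 := (map_ne_zero c).2 hp
  have hdp : d p = p := hHp d hd
  have hHp' (h : Ω ≃ₐ[k] Ω) (h1 : γ h = 0) (_ : δ h = 0) : h p = p := hHp h h1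
  set ρ := μ / p with hρ
  have hρ0 : ρ ≠ 0 := div_ne_zero hμ hp
  have hHρ (h : Ω ≃ₐ[k] Ω) (h1 : γ h = 0) (h2 : δ h = 0) : h ρ = ρ := by
    rw [hρ, map_div₀, hHμ h h1 h2, hHp h h1]
  have hcρ0 : c ρ ≠ 0 := (map_ne_zero c).2 hρ0
  have hcdρ : d ρ = c ρ := by
    rw [hρ, map_div₀, map_div₀, hdp, div_eq_div_iff hp hcp0]
    apply mul_left_cancel₀ hμ
    linear_combination hpm - p * hcμ
  have hce : c (ρ * c ρ) = ρ * c ρ := by rw [map_mul, hcc hHρ, mul_comm]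
  have hde : d (ρ * c ρ) = ρ * c ρ := by
    rw [map_mul, ← hcd hHρ, hcdρ, hcc hHρ, mul_comm]
  have hHe (h : Ω ≃ₐ[k] Ω) (h1 : γ h = 0) (h2 : δ h = 0) : h (ρ * c ρ) = ρ * c ρ := by
    rw [map_mul, hHρ h h1 h2, ← AlgEquiv.mul_apply, apply_eq_of_fixed hγ hδ hHρ (g' := c)
      (by rw [hγ.map_mul, h1, zero_add]) (by rw [hδ.map_mul, h2, zero_add])]
  have hge (g : Ω ≃ₐ[k] Ω) : g (ρ * c ρ) = ρ * c ρ := by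
    rcases ZMod.two_eq_zero_or_one (γ g) with h1 | h1 <;>
    rcases ZMod.two_eq_zero_or_one (δ g) with h2 | h2
    · exact hHe g h1 h2
    · rw [apply_eq_of_fixed hγ hδ hHe (h1.trans hd.symm) (h2.trans hd'.symm), hde]
    · rw [apply_eq_of_fixed hγ hδ hHe (h1.trans hc.symm) (h2.trans hc'.symm), hce]
    · rw [apply_eq_of_fixed hγ hδ hHe (g' := c * d) (by rw [hγ.map_mul, h1, hc, hd]; rfl)
        (by rw [hδ.map_mul, h2, hc', hd']; rfl), AlgEquiv.mul_apply, hde, hce]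
  obtain ⟨E, hE⟩ := IsAlgClosed.exists_pow_nat_eq (ρ * c ρ) (n := 2) two_pos
  have hE0 : E ≠ 0 := by
    rintro rfl
    rw [zero_pow two_ne_zero] at hE
    exact mul_ne_zero hρ0 hcρ0 hE.symm
  obtain ⟨ε, hε, hgE⟩ := exists_quadraticChar (k := k) hE0 fun g ↦ by rw [hE, hge]
  have hdiv {χ : (Ω ≃ₐ[k] Ω) → ZMod 2} {Z : Ω} (hgZ : ∀ g : Ω ≃ₐ[k] Ω, g Z = zsgn Ω (χ g) * Z)
      (g : Ω ≃ₐ[k] Ω) : g (Z / E) = zsgn Ω (χ g + ε g) * (Z / E) := by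
    rw [map_div₀, hgZ, hgE, zsgn_add]
    have := zsgn_ne_zero Ω (ε g)
    field_simp
    linear_combination -(zsgn Ω (χ g) * Z) * zsgn_mul_self Ω (ε g)
  obtain ⟨f₁, hf₁⟩ := exists_trivializesCup_of_norm (hγ.add hδ) hE0 hρ0 hgE
    (fun g hg ↦ by
      rcases ZMod.two_eq_zero_or_one (γ g) with h1 | h1
      · exact hHρ g h1 (by simpa [h1] using hg)
      · have h2 : δ g = 1 := by rw [h1] at hg; exact (CharTwo.add_eq_zero.1 hg).symm
        rw [apply_eq_of_fixed hγ hδ hHρ (g' := c * d) (by rw [hγ.map_mul, h1, hc, hd]; rfl)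
          (by rw [hδ.map_mul, h2, hc', hd']; rfl), AlgEquiv.mul_apply, hcdρ, hcc hHρ])
    (fun g hg ↦ by
      rw [hE]
      rcases ZMod.two_eq_zero_or_one (γ g) with h1 | h1
      · have h2 : δ g = 1 := by simpa [h1] using hg
        rw [apply_eq_of_fixed hγ hδ hHρ (h1.trans hd.symm) (h2.trans hd'.symm), hcdρ]
      · have h2 : δ g = 0 := by simpa [h1] using hg
        rw [apply_eq_of_fixed hγ hδ hHρ (h1.trans hc.symm) (h2.trans hc'.symm)])
  obtain ⟨f₂, hf₂⟩ := exists_trivializesCup_of_norm hγ (div_ne_zero hA hE0) hp (hdiv hgA) hHp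
    (fun g hg ↦ by
      have hgp : g p = c p := by
        rcases ZMod.two_eq_zero_or_one (δ g) with h2 | h2
        · exact apply_eq_of_fixed hγ hδ hHp' (hg.trans hc.symm) (h2.trans hc'.symm)
        · rw [apply_eq_of_fixed hγ hδ hHp' (g' := c * d) (by rw [hγ.map_mul, hg, hc, hd]; rfl)
            (by rw [hδ.map_mul, h2, hc', hd']; rfl), AlgEquiv.mul_apply, hdp]
      rw [hgp, div_pow, hE, hρ, map_div₀, ← hcμ]
      field_simp)
  have hκc : c (ν / ρ) = ν / ρ := by
    rw [map_div₀, div_eq_div_iff hcρ0 hρ0, ← hcdρ, hρ, map_div₀, hdp]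
    field_simp
    linear_combination hcdμν
  have hHκ (h : Ω ≃ₐ[k] Ω) (h1 : γ h = 0) (h2 : δ h = 0) : h (ν / ρ) = ν / ρ := by
    rw [map_div₀, hHν h h1 h2, hHρ h h1 h2]
  obtain ⟨f₃, hf₃⟩ := exists_trivializesCup_of_norm hδ (div_ne_zero hB hE0)
    (div_ne_zero hν hρ0) (hdiv hgB)
    (fun g hg ↦ by
      rcases ZMod.two_eq_zero_or_one (γ g) with h1 | h1
      · exact hHκ g h1 hg
      · rw [apply_eq_of_fixed hγ hδ hHκ (h1.trans hc.symm) (hg.trans hc'.symm), hκc])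
    (fun g hg ↦ by
      have hgκ : g (ν / ρ) = d (ν / ρ) := by
        rcases ZMod.two_eq_zero_or_one (γ g) with h1 | h1
        · exact apply_eq_of_fixed hγ hδ hHκ (h1.trans hd.symm) (hg.trans hd'.symm)
        · rw [apply_eq_of_fixed hγ hδ hHκ (g' := d * c) (by rw [hγ.map_mul, h1, hc, hd]; rfl)
            (by rw [hδ.map_mul, hg, hc', hd']; rfl), AlgEquiv.mul_apply, hκc]
      rw [hgκ, map_div₀, hcdρ, div_pow, hE, ← hdν]
      field_simp)
  exact ⟨ε, f₁, f₂, f₃, hε, hf₁, hf₂, hf₃⟩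

end CommonSlot

/-- The extension defined by a trivial sum of two cup products is contained in the compositum of the
`D₄` extensions of `ℚ`, since
`α ∪ γ + β ∪ δ = ε ∪ (γ + δ) + (α + ε) ∪ γ + (β + ε) ∪ δ` with each summand trivial. -/
lemma vanish_of_cup_add_cup {Ω : Type*} [Field Ω] [Algebra ℚ Ω] [IsGalois ℚ Ω] [IsAlgClosed Ω]
    {α β γ δ f : (Ω ≃ₐ[ℚ] Ω) → ZMod 2}
    (hα : IsQuadraticChar α) (hβ : IsQuadraticChar β) (hγ : IsQuadraticChar γ)
    (hδ : IsQuadraticChar δ) (hf : IsLocallyConstant f)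
    (hmul : ∀ g h, f (g * h) = f g + f h + (α g * γ h + β g * δ h))
    {c d : Ω ≃ₐ[ℚ] Ω} (hc : γ c = 1) (hc' : δ c = 0) (hd : γ d = 0) (hd' : δ d = 1)
    {σ : Ω ≃ₐ[ℚ] Ω} (hσ : σ ∈ (D4Compositum ℚ Ω).fixingSubgroup) : f σ = 0 := by
  have : CharZero Ω := algebraRat.charZero Ω
  obtain ⟨ε, f₁, f₂, f₃, hε, hf₁, hf₂, hf₃⟩ :=
    exists_common_slot hα hβ hγ hδ hf hmul hc hc' hd hd'
  have hsum : IsQuadraticChar (fun g ↦ f g + (f₁ g + (f₂ g + f₃ g))) :=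
    ⟨hf.comp₂ (hf₁.locConst.comp₂ (hf₂.locConst.comp₂ hf₃.locConst (· + ·)) (· + ·)) (· + ·),
      fun g h ↦ by
        rw [hmul, hf₁.map_mul, hf₂.map_mul, hf₃.map_mul]
        linear_combination (α g * γ h + β g * δ h + ε g * γ h + ε g * δ h) *
          CharTwo.two_eq_zero (R := ZMod 2)⟩
  simpa [hf₁.vanish hε (hγ.add hδ) hσ, hf₂.vanish (hα.add hε) hγ hσ,
    hf₃.vanish (hβ.add hε) hδ hσ] using hsum.vanish hσ

/-! ### A normal form for the three groups of order `64` -/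

/-- The central extension of `𝔽₂ ^ 4` (coordinates `a, b, c, d`) by `𝔽₂ ^ 2` (coordinates `u, v`)
defined by the bilinear cocycles `a b'` in the coordinate `v` and `a c' + (p b + q d) d'` in the
coordinate `u`. -/
@[ext]
structure PcModel (p q : ZMod 2) where
  (a b c d u v : ZMod 2)
  deriving DecidableEq

namespace PcModel

variable {p q : ZMod 2}

instance : Mul (PcModel p q) :=
  ⟨fun x y ↦ ⟨x.a + y.a, x.b + y.b, x.c + y.c, x.d + y.d,
    x.u + y.u + (x.a * y.c + (p * x.b + q * x.d) * y.d), x.v + y.v + x.a * y.b⟩⟩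

instance : One (PcModel p q) := ⟨⟨0, 0, 0, 0, 0, 0⟩⟩

instance : Inv (PcModel p q) :=
  ⟨fun x ↦ ⟨x.a, x.b, x.c, x.d, x.u + (x.a * x.c + (p * x.b + q * x.d) * x.d),
    x.v + x.a * x.b⟩⟩

@[simp] lemma mul_a (x y : PcModel p q) : (x * y).a = x.a + y.a := rfl
@[simp] lemma mul_b (x y : PcModel p q) : (x * y).b = x.b + y.b := rfl
@[simp] lemma mul_c (x y : PcModel p q) : (x * y).c = x.c + y.c := rfl
@[simp] lemma mul_d (x y : PcModel p q) : (x * y).d = x.d + y.d := rfl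
@[simp] lemma mul_u (x y : PcModel p q) :
    (x * y).u = x.u + y.u + (x.a * y.c + (p * x.b + q * x.d) * y.d) := rfl
@[simp] lemma mul_v (x y : PcModel p q) : (x * y).v = x.v + y.v + x.a * y.b := rfl
@[simp] lemma one_a : (1 : PcModel p q).a = 0 := rfl
@[simp] lemma one_b : (1 : PcModel p q).b = 0 := rfl
@[simp] lemma one_c : (1 : PcModel p q).c = 0 := rfl
@[simp] lemma one_d : (1 : PcModel p q).d = 0 := rfl
@[simp] lemma one_u : (1 : PcModel p q).u = 0 := rfl
@[simp] lemma one_v : (1 : PcModel p q).v = 0 := rfl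

instance : Group (PcModel p q) :=
  Group.ofLeftAxioms
    (fun x y z ↦ by ext <;> simp <;> ring)
    (fun x ↦ by ext <;> simp)
    (fun x ↦ by
      change (⟨_, _, _, _, _, _⟩ : PcModel p q) * x = 1
      have h2 := CharTwo.two_eq_zero (R := ZMod 2)
      ext
      · exact CharTwo.add_self_eq_zero _
      · exact CharTwo.add_self_eq_zero _
      · exact CharTwo.add_self_eq_zero _
      · exact CharTwo.add_self_eq_zero _
      · simp only [mul_u, one_u]
        linear_combination (x.u + x.a * x.c + (p * x.b + q * x.d) * x.d) * h2
      · simp only [mul_v, one_v]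
        linear_combination (x.v + x.a * x.b) * h2)

/-- The images of the six generators. -/
def gen : PcGen → PcModel p q
  | .a => ⟨1, 0, 0, 0, 0, 0⟩
  | .b => ⟨0, 1, 0, 0, 0, 0⟩
  | .c => ⟨0, 0, 1, 0, 0, 0⟩
  | .d => ⟨0, 0, 0, 1, 0, 0⟩
  | .u => ⟨0, 0, 0, 0, 1, 0⟩
  | .v => ⟨0, 0, 0, 0, 0, 1⟩

lemma pow_a (x : PcModel p q) (n : ℕ) : (x ^ n).a = n * x.a := by
  induction n with
  | zero => simp
  | succ n ih => rw [pow_succ, mul_a, ih]; push_cast; ring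

lemma pow_b (x : PcModel p q) (n : ℕ) : (x ^ n).b = n * x.b := by
  induction n with
  | zero => simp
  | succ n ih => rw [pow_succ, mul_b, ih]; push_cast; ring

lemma pow_c (x : PcModel p q) (n : ℕ) : (x ^ n).c = n * x.c := by
  induction n with
  | zero => simp
  | succ n ih => rw [pow_succ, mul_c, ih]; push_cast; ring

lemma pow_d (x : PcModel p q) (n : ℕ) : (x ^ n).d = n * x.d := by
  induction n with
  | zero => simp
  | succ n ih => rw [pow_succ, mul_d, ih]; push_cast; ring

lemma gen_u_pow (n : ℕ) : (gen .u : PcModel p q) ^ n = ⟨0, 0, 0, 0, n, 0⟩ := by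
  induction n with
  | zero => simp; rfl
  | succ n ih => rw [pow_succ, ih]; ext <;> simp [gen]

lemma gen_v_pow (n : ℕ) : (gen .v : PcModel p q) ^ n = ⟨0, 0, 0, 0, 0, n⟩ := by
  induction n with
  | zero => simp; rfl
  | succ n ih => rw [pow_succ, ih]; ext <;> simp [gen]

end PcModel

/-- In a group generated by `a, b, c, d, u, v` subject to the relations of the presentation, each
element has the form `a ^ i * b ^ j * c ^ l * d ^ m * u ^ r * v ^ s`. -/
lemma exists_normal_form {G : Type*} [Group G] {a b c d u v : G} {p q : ℕ}
    (hgen : ∀ K : Subgroup G, a ∈ K → b ∈ K → c ∈ K → d ∈ K → u ∈ K → v ∈ K → K = ⊤)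
    (ha : a ^ 2 = 1) (hb : b ^ 2 = 1) (hc : c ^ 2 = 1) (hd : d ^ 2 = u ^ q) (hu : u ^ 2 = 1)
    (hv : v ^ 2 = 1) (hcu : ∀ x, Commute x u) (hcv : ∀ x, Commute x v)
    (hba : b * a = a * b * v) (hca : c * a = a * c * u) (hda : d * a = a * d)
    (hcb : c * b = b * c) (hdb : d * b = b * d * u ^ p) (hdc : d * c = c * d) (g : G) :
    ∃ i j l m r s : ℕ, g = a ^ i * b ^ j * c ^ l * d ^ m * u ^ r * v ^ s := by
  have swap {x y z : G} (h : y * x = x * y * z) (hz : ∀ t, Commute t z) (n : ℕ) :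
      y * x ^ n = x ^ n * y * z ^ n := by
    induction n with
    | zero => simp
    | succ n ih =>
      calc y * x ^ (n + 1) = (y * x ^ n) * x := by rw [pow_succ, mul_assoc]
        _ = x ^ n * y * (z ^ n * x) := by rw [ih]; simp only [mul_assoc]
        _ = x ^ n * (y * x) * z ^ n := by
          rw [← ((hz x).pow_right n).eq]; simp only [mul_assoc]
        _ = x ^ (n + 1) * y * z ^ (n + 1) := by
          rw [h, pow_succ, pow_succ' z]; simp only [mul_assoc]
  have hcup (x : G) (n : ℕ) : Commute (u ^ n) x := ((hcu x).pow_right n).symm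
  have hcvp (x : G) (n : ℕ) : Commute (v ^ n) x := ((hcv x).pow_right n).symm
  let S : Set G := {g | ∃ i j l m r s : ℕ, g = a ^ i * b ^ j * c ^ l * d ^ m * u ^ r * v ^ s}
  have h1 : (1 : G) ∈ S := ⟨0, 0, 0, 0, 0, 0, by simp⟩
  have hSv : ∀ x ∈ S, v * x ∈ S := by
    rintro _ ⟨i, j, l, m, r, s, rfl⟩
    refine ⟨i, j, l, m, r, s + 1, ?_⟩
    rw [← (hcv _).eq, pow_succ]; simp only [mul_assoc]
  have hSu : ∀ x ∈ S, u * x ∈ S := by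
    rintro _ ⟨i, j, l, m, r, s, rfl⟩
    refine ⟨i, j, l, m, r + 1, s, ?_⟩
    rw [← (hcu _).eq, pow_succ, mul_assoc, (hcvp u s).eq]; simp only [mul_assoc]
  have hSup (n : ℕ) : ∀ x ∈ S, u ^ n * x ∈ S := by
    induction n with
    | zero => simp
    | succ n ih => intro x hx; rw [pow_succ', mul_assoc]; exact hSu _ (ih x hx)
  have hSvp (n : ℕ) : ∀ x ∈ S, v ^ n * x ∈ S := by
    induction n with
    | zero => simp
    | succ n ih => intro x hx; rw [pow_succ', mul_assoc]; exact hSv _ (ih x hx)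
  have hSa : ∀ x ∈ S, a * x ∈ S := by
    rintro _ ⟨i, j, l, m, r, s, rfl⟩
    exact ⟨i + 1, j, l, m, r, s, by rw [pow_succ']; simp only [mul_assoc]⟩
  have hSb : ∀ x ∈ S, b * x ∈ S := by
    rintro _ ⟨i, j, l, m, r, s, rfl⟩
    have e := hSvp i _ ⟨i, j + 1, l, m, r, s, rfl⟩
    have e1 := swap hba hcv i
    convert e using 1
    calc b * (a ^ i * b ^ j * c ^ l * d ^ m * u ^ r * v ^ s)
        = (b * a ^ i) * (b ^ j * c ^ l * d ^ m * u ^ r * v ^ s) := by simp only [mul_assoc]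
      _ = v ^ i * (a ^ i * b) * (b ^ j * c ^ l * d ^ m * u ^ r * v ^ s) := by
          rw [e1, (hcvp (a ^ i * b) i).eq]
      _ = _ := by rw [pow_succ']; simp only [mul_assoc]
  have hSc : ∀ x ∈ S, c * x ∈ S := by
    rintro _ ⟨i, j, l, m, r, s, rfl⟩
    have e := hSup i _ ⟨i, j, l + 1, m, r, s, rfl⟩
    have e1 := swap hca hcu i
    have e2 : c * b ^ j = b ^ j * c := (show Commute c b from hcb).pow_right j
    convert e using 1
    calc c * (a ^ i * b ^ j * c ^ l * d ^ m * u ^ r * v ^ s)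
        = (c * a ^ i) * (b ^ j * c ^ l * d ^ m * u ^ r * v ^ s) := by simp only [mul_assoc]
      _ = u ^ i * a ^ i * (c * b ^ j) * (c ^ l * d ^ m * u ^ r * v ^ s) := by
          rw [e1, ← (hcup (a ^ i * c) i).eq]; simp only [mul_assoc]
      _ = _ := by rw [e2, pow_succ']; simp only [mul_assoc]
  have hSd : ∀ x ∈ S, d * x ∈ S := by
    rintro _ ⟨i, j, l, m, r, s, rfl⟩
    have e := hSup (p * j) _ ⟨i, j, l, m + 1, r, s, rfl⟩
    have e1 : d * a ^ i = a ^ i * d := (show Commute d a from hda).pow_right i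
    have e2 : d * b ^ j = b ^ j * d * u ^ (p * j) := by
      rw [pow_mul]; exact swap hdb (fun t ↦ (hcu t).pow_right p) j
    have e3 : d * c ^ l = c ^ l * d := (show Commute d c from hdc).pow_right l
    convert e using 1
    calc d * (a ^ i * b ^ j * c ^ l * d ^ m * u ^ r * v ^ s)
        = (d * a ^ i) * (b ^ j * c ^ l * d ^ m * u ^ r * v ^ s) := by simp only [mul_assoc]
      _ = a ^ i * (d * b ^ j) * (c ^ l * d ^ m * u ^ r * v ^ s) := by
          rw [e1]; simp only [mul_assoc]
      _ = (a ^ i * b ^ j * d) * u ^ (p * j) * (c ^ l * d ^ m * u ^ r * v ^ s) := by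
          rw [e2]; simp only [mul_assoc]
      _ = u ^ (p * j) * (a ^ i * b ^ j * (d * c ^ l)) * (d ^ m * u ^ r * v ^ s) := by
          rw [← (hcup (a ^ i * b ^ j * d) (p * j)).eq]; simp only [mul_assoc]
      _ = _ := by rw [e3, pow_succ']; simp only [mul_assoc]
  -- inverses of generators preserve `S` too, as they are powers of the generators
  have hd4 : d ^ 4 = 1 := by
    rw [show 4 = 2 * 2 from rfl, pow_mul, hd, ← pow_mul, mul_comm, pow_mul, hu, one_pow]
  have inv_mem {x : G} (n : ℕ) (hx : x ^ (n + 1) = 1) (h : ∀ y ∈ S, x * y ∈ S) :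
      ∀ y ∈ S, x⁻¹ * y ∈ S := by
    have : x⁻¹ = x ^ n := inv_eq_of_mul_eq_one_left (by rw [← pow_succ, hx])
    rw [this]
    clear hx this
    induction n with
    | zero => simp
    | succ n ih => intro y hy; rw [pow_succ', mul_assoc]; exact h _ (ih y hy)
  let K : Subgroup G :=
    { carrier := {x | (∀ y ∈ S, x * y ∈ S) ∧ ∀ y ∈ S, x⁻¹ * y ∈ S}
      one_mem' := by simp
      mul_mem' := fun {x x'} hx hx' ↦
        ⟨fun y hy ↦ by rw [mul_assoc]; exact hx.1 _ (hx'.1 y hy),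
          fun y hy ↦ by rw [mul_inv_rev, mul_assoc]; exact hx'.2 _ (hx.2 y hy)⟩
      inv_mem' := fun {x} hx ↦ ⟨hx.2, by rw [inv_inv]; exact hx.1⟩ }
  have hK : K = ⊤ := hgen K ⟨hSa, inv_mem 1 ha hSa⟩ ⟨hSb, inv_mem 1 hb hSb⟩
    ⟨hSc, inv_mem 1 hc hSc⟩ ⟨hSd, inv_mem 3 hd4 hSd⟩ ⟨hSu, inv_mem 1 hu hSu⟩
    ⟨hSv, inv_mem 1 hv hSv⟩
  have hg : g ∈ K := hK ▸ Subgroup.mem_top g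
  have := hg.1 1 h1
  rwa [mul_one] at this

open PcGen in
/-- The relators hold in the model. -/
lemma lift_pcModelGen_eq_one {p q : ZMod 2} {sq : PcGen → FreeGroup PcGen} {bd : FreeGroup PcGen}
    (h : (sq = sqTrivial ∧ q = 0) ∨ (sq = sqD ∧ q = 1))
    (h' : (bd = 1 ∧ p = 0) ∨ (bd = FreeGroup.of u ∧ p = 1)) :
    ∀ r ∈ rels sq (FreeGroup.of v) (FreeGroup.of u) 1 1 bd 1,
      FreeGroup.lift (PcModel.gen (p := p) (q := q)) r = 1 := by
  rcases h with ⟨rfl, rfl⟩ | ⟨rfl, rfl⟩ <;> rcases h' with ⟨rfl, rfl⟩ | ⟨rfl, rfl⟩ <;>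
  · rintro r (((⟨x, rfl⟩ | ⟨x, rfl⟩) | ⟨x, rfl⟩) | rfl | rfl | rfl | rfl | rfl | rfl)
    · cases x <;> simp [sqTrivial, sqD] <;> decide
    · cases x <;> simp [commutatorElement_def] <;> decide
    · cases x <;> simp [commutatorElement_def] <;> decide
    all_goals simp [commutatorElement_def]; decide

open PcGen in
open scoped commutatorElement in
/-- The presented group is isomorphic to its model; only the injectivity and the preimages of the
generators `c` and `d` are recorded. -/
lemma exists_injective_hom_pcModel {p q : ZMod 2} {sq : PcGen → FreeGroup PcGen}
    {bd : FreeGroup PcGen}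
    (h : (sq = sqTrivial ∧ q = 0) ∨ (sq = sqD ∧ q = 1))
    (h' : (bd = 1 ∧ p = 0) ∨ (bd = FreeGroup.of u ∧ p = 1)) :
    ∃ Θ : PresentedGroup (rels sq (FreeGroup.of v) (FreeGroup.of u) 1 1 bd 1) →* PcModel p q,
      Function.Injective Θ ∧ PcModel.gen c ∈ Θ.range ∧ PcModel.gen d ∈ Θ.range := by
  set R := rels sq (FreeGroup.of v) (FreeGroup.of u) 1 1 bd 1 with hR
  let Θ := PresentedGroup.toGroup (lift_pcModelGen_eq_one h h')
  have hΘ (x : PcGen) : Θ (.of x) = PcModel.gen x := PresentedGroup.toGroup.of _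
  refine ⟨Θ, ?_, ⟨.of c, hΘ c⟩, ⟨.of d, hΘ d⟩⟩
  let g : PcGen → PresentedGroup R := .of
  have comm {x y : PcGen} {w : FreeGroup PcGen}
      (hm : ⁅FreeGroup.of x, FreeGroup.of y⁆ * w⁻¹ ∈ R) :
      g x * g y = PresentedGroup.mk R w * (g y * g x) := by
    have := PresentedGroup.one_of_mem hm
    rw [map_mul, map_inv, mul_inv_eq_one, map_commutatorElement, commutatorElement_def,
      mul_inv_eq_iff_eq_mul, mul_inv_eq_iff_eq_mul, mul_assoc] at this
    exact this
  have central {x y : PcGen} (hm : ⁅FreeGroup.of x, FreeGroup.of y⁆ ∈ R) :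
      Commute (g x) (g y) := by
    have := comm (x := x) (y := y) (w := 1) (by simpa using hm)
    rwa [map_one, one_mul] at this
  have hgen (K : Subgroup (PresentedGroup R)) (h : ∀ x, g x ∈ K) : K = ⊤ :=
    top_le_iff.1 fun y _ ↦ PresentedGroup.generated_by R K h y
  have hcen (y : PcGen) (hy : ∀ x, Commute (g x) (g y)) (x) : Commute x (g y) := by
    have := hgen (Subgroup.centralizer {g y}) fun x ↦
      Subgroup.mem_centralizer_singleton_iff.2 (hy x).eq
    exact Subgroup.mem_centralizer_singleton_iff.1 (this ▸ Subgroup.mem_top x)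
  have hcu := hcen u fun x ↦ central (Or.inl (Or.inl (Or.inr ⟨x, rfl⟩)))
  have hcv := hcen v fun x ↦ central (Or.inl (Or.inr ⟨x, rfl⟩))
  have hsq (x : PcGen) : g x ^ 2 = PresentedGroup.mk R (sq x) := by
    have := PresentedGroup.one_of_mem (rels := R) (Or.inl (Or.inl (Or.inl ⟨x, rfl⟩)))
    rwa [map_mul, map_inv, mul_inv_eq_one, map_pow] at this
  have hsq1 (x : PcGen) (hx : x ≠ d) : g x ^ 2 = 1 := by
    rw [hsq]
    rcases h with ⟨rfl, -⟩ | ⟨rfl, -⟩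
    · exact map_one _
    · cases x <;> first | exact map_one _ | exact absurd rfl hx
  have hd2 : g d ^ 2 = g u ^ q.val := by
    rw [hsq]
    rcases h with ⟨rfl, rfl⟩ | ⟨rfl, rfl⟩
    · exact map_one _
    · exact (pow_one _).symm
  have hbd : PresentedGroup.mk R bd = g u ^ p.val := by
    rcases h' with ⟨rfl, rfl⟩ | ⟨rfl, rfl⟩
    · exact map_one _
    · exact (pow_one _).symm
  -- `[x, y] = w` with `w` a central involution gives `y x = x y w`
  have swap {x y w : PresentedGroup R} (h : x * y = w * (y * x)) (hw : w ^ 2 = 1)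
      (hc : Commute (x * y) w) : y * x = x * y * w := by
    rw [hc.eq, h, ← mul_assoc, ← pow_two, hw, one_mul]
  have hup : (g u ^ p.val) ^ 2 = 1 := by
    rw [← pow_mul, mul_comm, pow_mul, hsq1 u nofun, one_pow]
  have hba := swap (comm (x := a) (y := b) (w := FreeGroup.of v) (by simp [hR, rels]))
    (hsq1 v nofun) (hcv _)
  have hca := swap (comm (x := a) (y := c) (w := FreeGroup.of u) (by simp [hR, rels]))
    (hsq1 u nofun) (hcu _)
  have hda := central (x := a) (y := d) (by simp [hR, rels])
  have hcb := central (x := b) (y := c) (by simp [hR, rels])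
  have hdb := swap (hbd ▸ comm (x := b) (y := d) (w := bd) (by simp [hR, rels]))
    hup ((hcu _).pow_right _)
  have hdc := central (x := c) (y := d) (by simp [hR, rels])
  rw [injective_iff_map_eq_one]
  intro t ht
  obtain ⟨i, j, l, m, r, s, rfl⟩ := exists_normal_form
    (fun K ha hb hc hd hu hv ↦ hgen K fun x ↦ by cases x <;> assumption)
    (hsq1 a nofun) (hsq1 b nofun) (hsq1 c nofun) hd2 (hsq1 u nofun)
    (hsq1 v nofun) hcu hcv hba hca hda.eq.symm hcb.eq.symm hdb hdc.eq.symm t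
  have even {n : ℕ} (hn : (n : ZMod 2) = 0) : 2 ∣ n := (ZMod.natCast_eq_zero_iff n 2).1 hn
  have kill (x : PcGen) (hx : x ≠ d) {n : ℕ} (hn : (n : ZMod 2) = 0) : g x ^ n = 1 := by
    obtain ⟨n, rfl⟩ := even hn
    rw [pow_mul, hsq1 x hx, one_pow]
  have hΘg (x : PcGen) (n : ℕ) : Θ (g x ^ n) = PcModel.gen x ^ n := by
    rw [map_pow]; exact congrArg (· ^ n) (hΘ x)
  have ht' := ht
  simp only [map_mul, hΘg] at ht'
  have hi : (i : ZMod 2) = 0 := by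
    simpa [PcModel.pow_a, PcModel.gen] using congrArg PcModel.a ht'
  have hj : (j : ZMod 2) = 0 := by
    simpa [PcModel.pow_b, PcModel.gen] using congrArg PcModel.b ht'
  have hl : (l : ZMod 2) = 0 := by
    simpa [PcModel.pow_c, PcModel.gen] using congrArg PcModel.c ht'
  have hm : (m : ZMod 2) = 0 := by
    simpa [PcModel.pow_d, PcModel.gen] using congrArg PcModel.d ht'
  obtain ⟨m, rfl⟩ := even hm
  -- an even power of `d` is a power of `u`
  have e : g a ^ i * g b ^ j * g c ^ l * g d ^ (2 * m) * g u ^ r * g v ^ s =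
      g u ^ (q.val * m + r) * g v ^ s := by
    rw [kill a nofun hi, kill b nofun hj, kill c nofun hl, pow_mul, hd2, ← pow_mul, one_mul,
      one_mul, one_mul, ← pow_add]
  rw [e] at ht ⊢
  rw [map_mul, hΘg, hΘg, PcModel.gen_u_pow, PcModel.gen_v_pow] at ht
  have hu0 : ((q.val * m + r : ℕ) : ZMod 2) = 0 := by
    simpa using congrArg PcModel.u ht
  have hv0 : (s : ZMod 2) = 0 := by
    simpa using congrArg PcModel.v ht
  rw [kill u nofun hu0, kill v nofun hv0, one_mul]

/-! ### Completeness of the compositum of the `D₄` extensions -/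

/-- An injective homomorphism from the finite Galois group of `K` inflates to a continuous
homomorphism from the Galois group of `Ω / k`, and `K` lies in every field `L` for which it kills
the Galois group of `Ω / L`. -/
lemma exists_hom_of_galois_equiv {k Ω G M : Type*} [Field k] [Field Ω] [Algebra k Ω] [IsGalois k Ω]
    [Group G] [Group M] [Finite M] (K : IntermediateField k Ω) (hK : IsGalois k K)
    (e : (K ≃ₐ[k] K) ≃* G) (Θ : G →* M) (hΘ : Function.Injective Θ) :
    ∃ Φ : (Ω ≃ₐ[k] Ω) →* M, IsLocallyConstant Φ ∧ Θ.range ≤ Φ.range ∧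
      ∀ L : IntermediateField k Ω, (∀ σ ∈ L.fixingSubgroup, Φ σ = 1) → K ≤ L := by
  have : Finite (K ≃ₐ[k] K) := Finite.of_injective (fun x ↦ Θ (e x)) (hΘ.comp e.injective)
  -- the Krull topology on the finite Hausdorff group `Gal(K / k)` is discrete
  have : DiscreteTopology (K ≃ₐ[k] K) := inferInstance
  let res : (Ω ≃ₐ[k] Ω) →* (K ≃ₐ[k] K) := AlgEquiv.restrictNormalHom K
  have hres : Function.Surjective res := AlgEquiv.restrictNormalHom_surjective Ω
  refine ⟨(Θ.comp e.toMonoidHom).comp res, ?_, ?_, fun L hL x hx ↦ ?_⟩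
  · exact ((IsLocallyConstant.iff_continuous res).2
      (InfiniteGalois.restrictNormalHom_continuous K)).comp fun x ↦ Θ (e x)
  · rintro _ ⟨y, rfl⟩
    obtain ⟨g, hg⟩ := hres (e.symm y)
    exact ⟨g, by simp [hg]⟩
  · rw [← InfiniteGalois.fixedField_fixingSubgroup L, IntermediateField.mem_fixedField_iff]
    intro σ hσ
    have h1 : Θ (e (res σ)) = 1 := hL σ hσ
    have h2 : res σ = 1 := e.injective (hΘ (h1.trans (by simp)))
    have h3 : ((res σ ⟨x, hx⟩ : K) : Ω) = σ x := AlgEquiv.restrictNormal_commutes σ K ⟨x, hx⟩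
    rw [← h3, h2, AlgEquiv.one_apply]

section Completeness

variable {Ω : Type*} [Field Ω] [Algebra ℚ Ω] [IsGalois ℚ Ω] [IsAlgClosed Ω]

/-- The coordinates of a continuous homomorphism to the model group are trivialised by the
extension `ℚ_{D₄}`: those in `𝔽₂ ^ 4` are quadratic characters, and those in the centre are cochains
whose coboundaries are `α ∪ β` and `α ∪ γ + (p β + q δ) ∪ δ`. -/
lemma pcModel_hom_vanish {p q : ZMod 2} (Φ : (Ω ≃ₐ[ℚ] Ω) →* PcModel p q) (hΦ : IsLocallyConstant Φ)
    (hc : PcModel.gen .c ∈ Φ.range) (hd : PcModel.gen .d ∈ Φ.range) {σ : Ω ≃ₐ[ℚ] Ω}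
    (hσ : σ ∈ (D4Compositum ℚ Ω).fixingSubgroup) : Φ σ = 1 := by
  have hα : IsQuadraticChar fun g ↦ (Φ g).a :=
    ⟨hΦ.comp PcModel.a, fun g h ↦ by rw [map_mul, PcModel.mul_a]⟩
  have hβ : IsQuadraticChar fun g ↦ (Φ g).b :=
    ⟨hΦ.comp PcModel.b, fun g h ↦ by rw [map_mul, PcModel.mul_b]⟩
  have hγ : IsQuadraticChar fun g ↦ (Φ g).c :=
    ⟨hΦ.comp PcModel.c, fun g h ↦ by rw [map_mul, PcModel.mul_c]⟩
  have hδ : IsQuadraticChar fun g ↦ (Φ g).d :=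
    ⟨hΦ.comp PcModel.d, fun g h ↦ by rw [map_mul, PcModel.mul_d]⟩
  have hβ' : IsQuadraticChar fun g ↦ p * (Φ g).b + q * (Φ g).d :=
    ⟨hΦ.comp fun x ↦ p * x.b + q * x.d, fun g h ↦ by
      rw [map_mul, PcModel.mul_b, PcModel.mul_d]; ring⟩
  have hv : TrivializesCup (fun g ↦ (Φ g).a) (fun g ↦ (Φ g).b) fun g ↦ (Φ g).v :=
    ⟨hΦ.comp PcModel.v, fun g h ↦ by rw [map_mul, PcModel.mul_v]⟩
  obtain ⟨c, hc⟩ := hc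
  obtain ⟨d, hd⟩ := hd
  have hu := vanish_of_cup_add_cup (f := fun g ↦ (Φ g).u) hα hβ' hγ hδ (hΦ.comp PcModel.u)
    (fun g h ↦ by rw [map_mul, PcModel.mul_u]) (c := c) (d := d)
    (by rw [hc]; rfl) (by rw [hc]; rfl) (by rw [hd]; rfl) (by rw [hd]; rfl) hσ
  exact PcModel.ext (hα.vanish hσ) (hβ.vanish hσ) (hγ.vanish hσ) (hδ.vanish hσ) hu
    (hv.vanish hα hβ hσ)

lemma isGComplete_of_pcModel {G : Type*} [Group G] {p q : ZMod 2} (Θ : G →* PcModel p q)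
    (hΘ : Function.Injective Θ) (hc : PcModel.gen .c ∈ Θ.range) (hd : PcModel.gen .d ∈ Θ.range) :
    IsGComplete (D4Compositum ℚ Ω) G := by
  rintro K hK ⟨e⟩
  have : Finite (PcModel p q) := Finite.of_injective
    (fun x ↦ (x.a, x.b, x.c, x.d, x.u, x.v)) fun x y h ↦ by
      simp only [Prod.mk.injEq] at h
      exact PcModel.ext h.1 h.2.1 h.2.2.1 h.2.2.2.1 h.2.2.2.2.1 h.2.2.2.2.2
  obtain ⟨Φ, hΦ, hrange, h⟩ := exists_hom_of_galois_equiv K hK e Θ hΘ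
  exact h _ fun σ hσ ↦ pcModel_hom_vanish Φ hΦ (hrange hc) (hrange hd) hσ

end Completeness

theorem mainTheorem2 (Ω : Type*) [Field Ω] [Algebra ℚ Ω] [IsAlgClosure ℚ Ω]
    (G : Type*) [Group G]
    (hG : Nonempty (G ≃* SmallGroup64_206) ∨ Nonempty (G ≃* SmallGroup64_215) ∨
      Nonempty (G ≃* SmallGroup64_216)) :
    IsGComplete (D4Compositum ℚ Ω) G := by
  have : IsAlgClosed Ω := IsAlgClosure.isAlgClosed ℚ
  have : IsGalois ℚ Ω := ⟨⟩
  have key {p q : ZMod 2} {P : Type} [Group P] (e : G ≃* P)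
      (h : ∃ Θ : P →* PcModel p q, Function.Injective Θ ∧ PcModel.gen .c ∈ Θ.range ∧
        PcModel.gen .d ∈ Θ.range) : IsGComplete (D4Compositum ℚ Ω) G := by
    obtain ⟨Θ, hΘ, ⟨c, hc⟩, d, hd⟩ := h
    exact isGComplete_of_pcModel (Θ.comp e.toMonoidHom) (hΘ.comp e.injective)
      ⟨e.symm c, by simp [hc]⟩ ⟨e.symm d, by simp [hd]⟩
  rcases hG with ⟨⟨e⟩⟩ | ⟨⟨e⟩⟩ | ⟨⟨e⟩⟩
  · exact key e (exists_injective_hom_pcModel (Or.inr ⟨rfl, rfl⟩) (Or.inl ⟨rfl, rfl⟩))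
  · exact key e (exists_injective_hom_pcModel (Or.inl ⟨rfl, rfl⟩) (Or.inr ⟨rfl, rfl⟩))
  · exact key e (exists_injective_hom_pcModel (Or.inr ⟨rfl, rfl⟩) (Or.inr ⟨rfl, rfl⟩))
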